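/- Let $\Gamma$ be a finite simple distance-regular graph with diameter $D\ge 3$: $\Gamma$ is connected and there are integers $b_i,c_i$ $(0\le i\le D)$ such that for any two vertices $x,y$ at distance $i$, exactly $c_i$ neighbours of $y$ are at distance $i-1$ from $x$ and exactly $b_i$ neighbours of $y$ are at distance $i+1$ from $x$ (so $c_0=b_D=0$). Let $k=b_0$ be its valency and $a_1=k-b_1-c_1$, the number of common neighbours of two adjacent vertices. Let $k=\theta_0>\theta_1>\cdots>\theta_D$ be the distinct eigenvalues of the adjacency matrix of $\Gamma$. Let $x$ be a vertex and let $a_1=\eta_1\ge\eta_2\ge\cdots\ge\eta_k$ be the eigenvalues, with multiplicity, of the adjacency matrix of the local graph at $x$, that is, of the subgraph of $\Gamma$ induced on the $k$ neighbours of $x$; here $k\ge 2$. Then $$\theta_1>\eta_2\ge\eta_k>\theta_D,$$ and $\eta_2=\eta_k$ holds if and only if $a_1=0$. In particular, $\theta_1>\eta_2>\eta_k>\theta_D$ whenever $a_1\neq 0$. -/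

import Mathlib

namespace SimpleGraph

/-- `G.IsDistanceRegular b c`: the finite graph `G` is connected, and for all vertices `x`, `y` at
distance `i` there are exactly `c i` neighbours of `y` at distance `i - 1` from `x`, and exactly
`b i` neighbours of `y` at distance `i + 1` from `x`. Only the values `b i`, `c i` with
`i ≤ G.diam` matter, and the conditions force `c 0 = 0` and `b G.diam = 0`. -/
structure IsDistanceRegular {V : Type*} [Fintype V] (G : SimpleGraph V) [DecidableRel G.Adj]
    (b c : ℕ → ℕ) : Prop where
  connected : G.Connected
  card_closer : ∀ x y : V,
    ((G.neighborFinset y).filter fun z => G.dist x z + 1 = G.dist x y).card = c (G.dist x y)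
  card_farther : ∀ x y : V,
    ((G.neighborFinset y).filter fun z => G.dist x z = G.dist x y + 1).card = b (G.dist x y)

/-- The intersection number `a i = k - b i - c i`, where `k = b 0` is the valency. -/
def intersectionA (b c : ℕ → ℕ) (i : ℕ) : ℤ := (b 0 : ℤ) - b i - c i

/-- The local graph at `x`: the subgraph induced on the set of neighbours of `x`. -/
abbrev localGraph {V : Type*} (G : SimpleGraph V) (x : V) : SimpleGraph (G.neighborSet x) :=
  G.induce (G.neighborSet x)

/-- `θ 0 > θ 1 > ⋯ > θ (m - 1)` are precisely the distinct eigenvalues of the (real) adjacency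
matrix of `G`. These conditions determine `m` and `θ`. -/
structure IsDistinctEigenvalues {V : Type*} [Fintype V] [DecidableEq V] (G : SimpleGraph V)
    [DecidableRel G.Adj] {m : ℕ} (θ : Fin m → ℝ) : Prop where
  strictAnti : StrictAnti θ
  range_eq : Set.range θ = spectrum ℝ (G.adjMatrix ℝ)

/-- `η 0 ≥ η 1 ≥ ⋯ ≥ η (n - 1)` are the eigenvalues of the (real) adjacency matrix of `G`, each
listed as often as its multiplicity. These conditions determine `n` and `η`. -/
structure IsEigenvalues {V : Type*} [Fintype V] [DecidableEq V] (G : SimpleGraph V)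
    [DecidableRel G.Adj] {n : ℕ} (η : Fin n → ℝ) : Prop where
  antitone : Antitone η
  roots_eq : (Finset.univ : Finset (Fin n)).val.map η = (G.adjMatrix ℝ).charpoly.roots

end SimpleGraph

/-! Extend an eigenvector `u` of the local graph at `x` by zero to all vertices. The extension has
the same Rayleigh quotient `η` for the adjacency matrix of `G`, so `η` is at least the least
eigenvalue of `G`. If `u` is orthogonal to the constants, so is its extension; by connectedness the
constants form the whole top eigenspace, so `η` is at most the second eigenvalue. Equality in either
bound would make the extension an eigenvector of `G` (`mulVec_eq_smul_of_le`). `eigenvector_eq_zero`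
excludes this: for `y` adjacent to `x`, the sphere of radius `D ≥ 3` about `y` misses the support,
and the three-term recurrence for sphere sums forces the value at `y` to vanish. If all local
eigenvalues after the first coincide and `a₁ ≠ 0`, the diagonal of a quadratic relation and the
trace show that the local graph is complete, against `b₁ > 0`. -/

namespace Matrix

/-! ### Real symmetric matrices: eigenvectors, Rayleigh quotients, polynomials. -/

open Polynomial

variable {n : Type*} [Fintype n] [DecidableEq n] {A : Matrix n n ℝ}

/-- A real symmetric matrix has a sorted list of eigenvalues with an orthonormal list of
eigenvectors. -/
theorem IsHermitian.exists_sorted_eigenbasis (hA : A.IsHermitian) {m : ℕ}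
    (hm : Fintype.card n = m) :
    ∃ (η : Fin m → ℝ) (u : Fin m → n → ℝ), Antitone η ∧
      (Finset.univ : Finset (Fin m)).val.map η = A.charpoly.roots ∧
      (∀ i, A *ᵥ u i = η i • u i) ∧ (∀ i j, u i ⬝ᵥ u j = if i = j then 1 else 0) ∧
      ∀ v, ∑ i, (u i ⬝ᵥ v) • u i = v := by
  subst hm
  let e : Fin (Fintype.card n) ≃ n := Fintype.equivOfCardEq (Fintype.card_fin _)
  have he : ∀ i, hA.eigenvalues (e i) = hA.eigenvalues₀ i := fun i => by
    simp [IsHermitian.eigenvalues, e]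
  refine ⟨hA.eigenvalues₀, fun i => (hA.eigenvectorBasis (e i)).ofLp, hA.eigenvalues₀_antitone,
    ?_, fun i => ?_, fun i j => ?_, fun v => ?_⟩
  · rw [hA.roots_charpoly_eq_eigenvalues₀]; rfl
  · rw [hA.mulVec_eigenvectorBasis, he]
  · have := orthonormal_iff_ite.1 hA.eigenvectorBasis.orthonormal (e j) (e i)
    rw [EuclideanSpace.inner_eq_star_dotProduct] at this
    simpa [eq_comm] using this
  · have := hA.eigenvectorBasis.sum_repr' (WithLp.toLp 2 v)
    rw [← e.sum_comp] at this
    have h2 := congrArg WithLp.ofLp this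
    simpa [EuclideanSpace.inner_eq_star_dotProduct, dotProduct_comm] using h2

theorem mem_spectrum_of_mulVec_eq {μ : ℝ} {v : n → ℝ} (hv : v ≠ 0) (h : A *ᵥ v = μ • v) :
    μ ∈ spectrum ℝ A := by
  rw [← spectrum_toLin']
  exact (Module.End.hasEigenvalue_of_hasEigenvector (f := A.toLin')
    (Module.End.hasEigenvector_iff.2 ⟨Module.End.mem_eigenspace_iff.2 (by simpa using h),
      hv⟩)).mem_spectrum

theorem exists_mulVec_eq_of_mem_spectrum {μ : ℝ} (h : μ ∈ spectrum ℝ A) :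
    ∃ v : n → ℝ, v ≠ 0 ∧ A *ᵥ v = μ • v := by
  rw [← spectrum_toLin'] at h
  obtain ⟨v, hv⟩ := (Module.End.HasEigenvalue.of_mem_spectrum h).exists_hasEigenvector
  exact ⟨v, hv.2, by simpa using hv.apply_eq_smul⟩

/-- If `v` is orthogonal to all eigenvectors of `A` with eigenvalue above `t` and its Rayleigh
quotient is at least `t`, then `v` is a `t`-eigenvector. -/
theorem IsHermitian.mulVec_eq_smul_of_le (hA : A.IsHermitian) {t : ℝ} {v : n → ℝ}
    (h : ∀ μ w, A *ᵥ w = μ • w → t < μ → w ⬝ᵥ v = 0)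
    (hv : t * (v ⬝ᵥ v) ≤ v ⬝ᵥ A *ᵥ v) : A *ᵥ v = t • v := by
  obtain ⟨η, u, -, -, hu, ho, hs⟩ := hA.exists_sorted_eigenbasis rfl
  have hAv : A *ᵥ v = ∑ i, (u i ⬝ᵥ v) • η i • u i := by
    conv_lhs => rw [← hs v, mulVec_sum]
    simp [mulVec_smul, hu]
  have h1 : v ⬝ᵥ v = ∑ i, (u i ⬝ᵥ v) * (u i ⬝ᵥ v) := by
    conv_lhs => rw [← hs v, sum_dotProduct]
    simp [smul_dotProduct, hs v]
  have h2 : v ⬝ᵥ A *ᵥ v = ∑ i, (u i ⬝ᵥ v) * (η i * (u i ⬝ᵥ v)) := by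
    rw [hAv, dotProduct_sum]
    simp [dotProduct_comm v]
  rw [h1, h2, Finset.mul_sum, ← sub_nonpos, ← Finset.sum_sub_distrib] at hv
  -- Coordinates with `η i > t` vanish by orthogonality, so every term is nonnegative. Since the sum
  -- is at most zero, each term is zero.
  have h3 : ∀ i ∈ Finset.univ, 0 ≤ t * ((u i ⬝ᵥ v) * (u i ⬝ᵥ v)) -
      (u i ⬝ᵥ v) * (η i * (u i ⬝ᵥ v)) := by
    intro i _
    rcases lt_or_ge t (η i) with hi | hi
    · simp [h _ _ (hu i) hi]
    · nlinarith [mul_self_nonneg (u i ⬝ᵥ v)]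
  have h4 := (Finset.sum_eq_zero_iff_of_nonneg h3).1 (le_antisymm hv (Finset.sum_nonneg h3))
  rw [hAv]
  conv_rhs => rw [← hs v, Finset.smul_sum]
  refine Finset.sum_congr rfl fun i hi => ?_
  have h5 : (u i ⬝ᵥ v) * ((t - η i) * (u i ⬝ᵥ v)) = 0 := by linear_combination h4 i hi
  rcases mul_eq_zero.1 h5 with h6 | h6
  · simp [h6]
  · rw [smul_smul, smul_smul]; congr 1; linear_combination -h6

theorem aeval_mulVec_of_mulVec_eq {μ : ℝ} {v : n → ℝ} (h : A *ᵥ v = μ • v) (p : ℝ[X]) :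
    aeval A p *ᵥ v = p.eval μ • v := by
  induction p using Polynomial.induction_on' with
  | add p q hp hq => simp [add_mulVec, hp, hq, add_smul]
  | monomial k a =>
    have hk : A ^ k *ᵥ v = μ ^ k • v := by
      induction k with
      | zero => simp
      | succ k ih => rw [pow_succ, ← mulVec_mulVec, h, mulVec_smul, ih, smul_smul, pow_succ']
    rw [aeval_monomial, eval_monomial, Algebra.algebraMap_eq_smul_one, smul_mul_assoc, one_mul,
      smul_mulVec, hk, smul_smul]

theorem IsHermitian.aeval_eq_zero (hA : A.IsHermitian) {p : ℝ[X]}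
    (hp : ∀ μ ∈ spectrum ℝ A, p.eval μ = 0) : aeval A p = 0 := by
  obtain ⟨η, u, -, hη, hu, ho, hs⟩ := hA.exists_sorted_eigenbasis rfl
  refine Matrix.ext_iff_mulVec.2 fun v => ?_
  rw [zero_mulVec, ← hs v, mulVec_sum]
  refine Finset.sum_eq_zero fun i _ => ?_
  have hi : u i ≠ 0 := fun h0 => by simpa [h0] using ho i i
  rw [mulVec_smul, aeval_mulVec_of_mulVec_eq (hu i), hp _ (mem_spectrum_of_mulVec_eq hi (hu i)),
    zero_smul, smul_zero]

end Matrix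

namespace SimpleGraph

open Matrix Polynomial

/-! ### The top eigenvalue of a regular graph, via the Laplacian. -/

section Regular

variable {V : Type*} [Fintype V] [DecidableEq V] {G : SimpleGraph V} [DecidableRel G.Adj]

theorem IsRegularOfDegree.lapMatrix_mulVec {d : ℕ} (hd : G.IsRegularOfDegree d) {μ : ℝ}
    {v : V → ℝ} (h : G.adjMatrix ℝ *ᵥ v = μ • v) :
    G.lapMatrix ℝ *ᵥ v = (d - μ) • v := by
  ext i
  have := congrFun h i
  rw [lapMatrix, sub_mulVec, Pi.sub_apply, degMatrix_mulVec_apply, this, hd i]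
  simp [sub_mul]

theorem IsRegularOfDegree.eigenvalue_le {d : ℕ} (hd : G.IsRegularOfDegree d) {μ : ℝ}
    {v : V → ℝ} (hv : v ≠ 0) (h : G.adjMatrix ℝ *ᵥ v = μ • v) : μ ≤ d := by
  have h1 := (posSemidef_lapMatrix ℝ G).dotProduct_mulVec_nonneg v
  rw [hd.lapMatrix_mulVec h, star_trivial, dotProduct_smul, smul_eq_mul] at h1
  have h2 : 0 < v ⬝ᵥ v :=
    lt_of_le_of_ne (Finset.sum_nonneg fun i _ => mul_self_nonneg (v i))
      fun h0 => hv (dotProduct_self_eq_zero.1 h0.symm)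
  nlinarith [nonneg_of_mul_nonneg_left h1 h2]

theorem IsRegularOfDegree.eigenvector_eq (hG : G.Connected) {d : ℕ}
    (hd : G.IsRegularOfDegree d) {v : V → ℝ} (h : G.adjMatrix ℝ *ᵥ v = (d : ℝ) • v) (x y : V) :
    v x = v y := by
  have h1 : G.lapMatrix ℝ *ᵥ v = 0 := by rw [hd.lapMatrix_mulVec h]; simp
  exact (lapMatrix_mulVec_eq_zero_iff_forall_reachable G).1 h1 x y (hG.preconnected x y)

omit [DecidableEq V] in
theorem IsRegularOfDegree.adjMatrix_mulVec_one {d : ℕ} (hd : G.IsRegularOfDegree d) :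
    G.adjMatrix ℝ *ᵥ 1 = (d : ℝ) • 1 := by
  ext i
  simp [hd i]

theorem IsRegularOfDegree.mem_spectrum [Nonempty V] {d : ℕ} (hd : G.IsRegularOfDegree d) :
    (d : ℝ) ∈ spectrum ℝ (G.adjMatrix ℝ) :=
  mem_spectrum_of_mulVec_eq one_ne_zero hd.adjMatrix_mulVec_one

end Regular

/-! ### Distances and intersection numbers. -/

theorem Connected.exists_adj_dist_add_one_eq {V : Type*} {G : SimpleGraph V} (hG : G.Connected)
    {x z : V} (h : 0 < G.dist x z) : ∃ y, G.Adj y z ∧ G.dist x y + 1 = G.dist x z := by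
  obtain ⟨p, hp⟩ := hG.exists_walk_length_eq_dist z x
  rw [dist_comm] at hp
  cases p with
  | nil => simp at h
  | @cons _ y _ hy p =>
    refine ⟨y, hy.symm, ?_⟩
    have h1 := dist_le p
    have h2 := hG.dist_triangle (u := x) (v := y) (w := z)
    rw [dist_eq_one_iff_adj.2 hy.symm] at h2
    rw [dist_comm] at h1
    simp only [Walk.length_cons] at hp
    omega

theorem Connected.dist_le_diam' {V : Type*} [Finite V] {G : SimpleGraph V} (hG : G.Connected)
    (x y : V) : G.dist x y ≤ G.diam := by
  have := hG.nonempty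
  exact dist_le_diam (connected_iff_ediam_ne_top.1 hG)

theorem Connected.exists_dist_eq {V : Type*} [Finite V] {G : SimpleGraph V} (hG : G.Connected)
    {i : ℕ} (hi : i ≤ G.diam) : ∃ x y, G.dist x y = i := by
  induction hi using Nat.decreasingInduction with
  | self =>
    have := hG.nonempty
    exact exists_dist_eq_diam
  | of_succ j hj ih =>
    obtain ⟨x, z, hxz⟩ := ih
    obtain ⟨y, -, hy⟩ := hG.exists_adj_dist_add_one_eq (x := x) (z := z) (by omega)
    exact ⟨x, y, by omega⟩

namespace IsDistanceRegular

variable {V : Type*} [Fintype V] {G : SimpleGraph V} [DecidableRel G.Adj]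
  {b c : ℕ → ℕ}

theorem isRegularOfDegree (hG : G.IsDistanceRegular b c) : G.IsRegularOfDegree (b 0) := by
  intro x
  have := hG.card_farther x x
  rw [dist_self, Finset.filter_true_of_mem, card_neighborFinset_eq_degree] at this
  · exact this
  · intro z hz
    rw [mem_neighborFinset] at hz
    simpa using hz

theorem b_pos (hG : G.IsDistanceRegular b c) {i : ℕ} (hi : i < G.diam) : 0 < b i := by
  obtain ⟨x, z, hxz⟩ := hG.connected.exists_dist_eq (i := i + 1) hi
  obtain ⟨y, hyz, hy⟩ := hG.connected.exists_adj_dist_add_one_eq (x := x) (z := z) (by omega)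
  have : G.dist x y = i := by omega
  rw [← this, ← hG.card_farther, Finset.card_pos]
  exact ⟨z, by simp [hyz, hy]⟩

theorem c_one (hG : G.IsDistanceRegular b c) (hD : 0 < G.diam) : c 1 = 1 := by
  obtain ⟨x, y, hxy⟩ := hG.connected.exists_dist_eq (i := 1) hD
  have h1 := hG.card_closer x y
  rw [hxy] at h1
  rw [← h1, Finset.card_eq_one]
  refine ⟨x, ?_⟩
  ext z
  have hadj := dist_eq_one_iff_adj.1 hxy
  simp only [Finset.mem_filter, mem_neighborFinset, Nat.add_eq_right, Finset.mem_singleton,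
    hG.connected.dist_eq_zero_iff]
  exact ⟨fun h => h.2.symm, fun h => ⟨h ▸ hadj.symm, h.symm⟩⟩

/-- Neighbours of `y` at the same distance from `x` as `y`. -/
theorem card_same (hG : G.IsDistanceRegular b c) (x y : V) :
    ((G.neighborFinset y).filter fun z => G.dist x z = G.dist x y).card + b (G.dist x y) +
      c (G.dist x y) = b 0 := by
  classical
  rw [← hG.card_closer, ← hG.card_farther, ← hG.isRegularOfDegree y,
    ← card_neighborFinset_eq_degree, ← Finset.card_union_of_disjoint,
    ← Finset.card_union_of_disjoint]
  · congr 1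
    ext z
    simp only [Finset.mem_union, Finset.mem_filter, mem_neighborFinset]
    constructor
    · tauto
    · intro h
      have h1 := hG.connected.dist_triangle (u := x) (v := y) (w := z)
      have h2 := hG.connected.dist_triangle (u := x) (v := z) (w := y)
      rw [dist_eq_one_iff_adj.2 h] at h1
      rw [dist_eq_one_iff_adj.2 h.symm] at h2
      have : G.dist x z = G.dist x y ∨ G.dist x z = G.dist x y + 1 ∨
        G.dist x z + 1 = G.dist x y := by omega
      tauto
  · rw [← Finset.filter_or, Finset.disjoint_filter]
    intros; omega
  · rw [Finset.disjoint_filter]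
    intros; omega

/-- This is the three-term relation for the product of the adjacency matrix and the `i`-th distance
matrix, read entrywise. Writing `b (G.dist y w)` instead of `b (i - 1)` avoids a separate case `i =
0`. -/
theorem card_neighbor_dist_eq (hG : G.IsDistanceRegular b c) (y w : V) (i : ℕ) :
    (((G.neighborFinset w).filter fun z => G.dist y z = i).card : ℝ) =
      (if G.dist y w = i + 1 then (c (i + 1) : ℝ) else 0) +
      (if G.dist y w = i then (intersectionA b c i : ℝ) else 0) +
      (if G.dist y w + 1 = i then (b (G.dist y w) : ℝ) else 0) := by
  rcases lt_trichotomy (G.dist y w) i with h | h | h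
  · rcases Nat.lt_or_ge (G.dist y w + 1) i with h' | h'
    · rw [if_neg (by omega), if_neg (by omega), if_neg (by omega), Finset.filter_false_of_mem]
      · simp
      · intro z hz
        have h1 := hG.connected.dist_triangle (u := y) (v := w) (w := z)
        rw [dist_eq_one_iff_adj.2 ((mem_neighborFinset _ _ _).1 hz)] at h1
        omega
    · obtain rfl : G.dist y w + 1 = i := by omega
      rw [if_neg (by omega), if_neg (by omega), if_pos rfl, hG.card_farther]
      simp
  · subst h
    have := hG.card_same y w
    rw [if_neg (by omega), if_pos rfl, if_neg (by omega), intersectionA, ← this]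
    push_cast
    ring
  · rcases Nat.lt_or_ge (i + 1) (G.dist y w) with h' | h'
    · rw [if_neg (by omega), if_neg (by omega), if_neg (by omega), Finset.filter_false_of_mem]
      · simp
      · intro z hz
        have h1 := hG.connected.dist_triangle (u := y) (v := z) (w := w)
        rw [dist_eq_one_iff_adj.2 ((mem_neighborFinset _ _ _).1 hz).symm] at h1
        omega
    · have h1 : G.dist y w = i + 1 := by omega
      have h2 := hG.card_closer y w
      simp only [h1, Nat.add_right_cancel_iff] at h2
      rw [if_pos h1, if_neg (by omega), if_neg (by omega), h2]
      simp

end IsDistanceRegular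

/-! ### Sphere sums of eigenvectors. -/

/-- The sum of `v` over the vertices at distance `i` from `y`. -/
noncomputable def sphereSum {V : Type*} [Fintype V] (G : SimpleGraph V) (v : V → ℝ) (y : V)
    (i : ℕ) : ℝ :=
  ∑ z, if G.dist y z = i then v z else 0

section SphereSum

variable {V : Type*} [Fintype V] {G : SimpleGraph V} {v : V → ℝ}

theorem Connected.sphereSum_zero (hG : G.Connected) (y : V) : G.sphereSum v y 0 = v y := by
  classical
  simp [sphereSum, hG.dist_eq_zero_iff]

theorem Connected.sphereSum_eq_zero (hG : G.Connected) (y : V) {i : ℕ} (hi : G.diam < i) :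
    G.sphereSum v y i = 0 := by
  refine Finset.sum_eq_zero fun z _ => if_neg ?_
  have := hG.dist_le_diam' y z
  omega

namespace IsDistanceRegular

variable [DecidableRel G.Adj] {b c : ℕ → ℕ}

theorem mul_sphereSum (hG : G.IsDistanceRegular b c) {μ : ℝ} (h : G.adjMatrix ℝ *ᵥ v = μ • v)
    (y : V) (i : ℕ) :
    μ * G.sphereSum v y i = c (i + 1) * G.sphereSum v y (i + 1) +
      intersectionA b c i * G.sphereSum v y i +
      ∑ w, if G.dist y w + 1 = i then b (G.dist y w) * v w else 0 := by
  classical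
  -- Replace each `μ * v z` by the sum of `v` over the neighbours of `z`, then exchange the two
  -- sums.
  have h1 : μ * G.sphereSum v y i =
      ∑ w, (((G.neighborFinset w).filter fun z => G.dist y z = i).card : ℝ) * v w := by
    have : ∀ z, μ * v z = ∑ w, if G.Adj z w then v w else 0 := fun z => by
      have := congrFun h z
      rw [Pi.smul_apply, smul_eq_mul] at this
      rw [← this, adjMatrix_mulVec_apply, ← Finset.sum_filter]
      congr 1
      ext; simp
    have h2 : ∀ z, μ * (if G.dist y z = i then v z else 0) =
        ∑ w, if G.dist y z = i then (if G.Adj z w then v w else 0) else 0 := fun z => by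
      split_ifs
      · exact this z
      · simp
    rw [sphereSum, Finset.mul_sum, Finset.sum_congr rfl fun z _ => h2 z, Finset.sum_comm]
    refine Finset.sum_congr rfl fun w _ => ?_
    rw [Finset.card_filter, Nat.cast_sum, Finset.sum_mul]
    rw [← Finset.sum_subset (Finset.subset_univ (G.neighborFinset w))]
    · refine Finset.sum_congr rfl fun z hz => ?_
      rw [mem_neighborFinset] at hz
      simp [hz.symm]
    · intro z _ hz
      rw [mem_neighborFinset] at hz
      rw [if_neg fun h : G.Adj z w => hz h.symm, ite_self]
  rw [h1, sphereSum, sphereSum, Finset.mul_sum, Finset.mul_sum, ← Finset.sum_add_distrib,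
    ← Finset.sum_add_distrib]
  refine Finset.sum_congr rfl fun w _ => ?_
  rw [hG.card_neighbor_dist_eq]
  split_ifs <;> ring

theorem mul_sphereSum_zero (hG : G.IsDistanceRegular b c) {μ : ℝ}
    (h : G.adjMatrix ℝ *ᵥ v = μ • v) (y : V) :
    μ * G.sphereSum v y 0 = c 1 * G.sphereSum v y 1 +
      intersectionA b c 0 * G.sphereSum v y 0 := by
  rw [hG.mul_sphereSum h]
  simp

theorem mul_sphereSum_succ (hG : G.IsDistanceRegular b c) {μ : ℝ}
    (h : G.adjMatrix ℝ *ᵥ v = μ • v) (y : V) (i : ℕ) :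
    μ * G.sphereSum v y (i + 1) = c (i + 2) * G.sphereSum v y (i + 2) +
      intersectionA b c (i + 1) * G.sphereSum v y (i + 1) + b i * G.sphereSum v y i := by
  rw [hG.mul_sphereSum h]
  congr 1
  rw [sphereSum, Finset.mul_sum]
  refine Finset.sum_congr rfl fun w _ => ?_
  by_cases hw : G.dist y w = i <;> simp [hw]

theorem eigenvector_apply_eq_zero (hG : G.IsDistanceRegular b c) {μ : ℝ}
    (h : G.adjMatrix ℝ *ᵥ v = μ • v) {y : V} (hy : G.sphereSum v y G.diam = 0) : v y = 0 := by
  -- Two consecutive zeros propagate downwards from `G.diam`, because the coefficient `b j` in the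
  -- recurrence is nonzero for `j < G.diam`.
  suffices H : ∀ i ≤ G.diam, G.sphereSum v y i = 0 ∧ G.sphereSum v y (i + 1) = 0 by
    rw [← hG.connected.sphereSum_zero (v := v) y]
    exact (H 0 (Nat.zero_le _)).1
  intro i hi
  induction hi using Nat.decreasingInduction with
  | self => exact ⟨hy, hG.connected.sphereSum_eq_zero y (Nat.lt_succ_self _)⟩
  | of_succ j hj ih =>
    refine ⟨?_, ih.1⟩
    have h1 := hG.mul_sphereSum_succ h y j
    rw [ih.1, ih.2] at h1
    have h2 : (b j : ℝ) ≠ 0 := by exact_mod_cast (hG.b_pos hj).ne'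
    exact (mul_eq_zero.1 (by linarith : (b j : ℝ) * G.sphereSum v y j = 0)).resolve_left h2

/-- No eigenvector of a distance-regular graph of diameter at least `3` is supported on the
neighbours of a vertex. -/
theorem eigenvector_eq_zero (hG : G.IsDistanceRegular b c) (hD : 3 ≤ G.diam) {μ : ℝ}
    (h : G.adjMatrix ℝ *ᵥ v = μ • v) {x : V} (hx : ∀ z, ¬ G.Adj x z → v z = 0) : v = 0 := by
  ext y
  by_cases hy : G.Adj x y
  · refine hG.eigenvector_apply_eq_zero h (Finset.sum_eq_zero fun z _ => ?_)
    by_cases hz : G.Adj x z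
    -- Two neighbours of `x` are at distance at most `2 < G.diam`.
    · refine if_neg ?_
      have h1 := hG.connected.dist_triangle (u := y) (v := x) (w := z)
      rw [dist_eq_one_iff_adj.2 hy.symm, dist_eq_one_iff_adj.2 hz] at h1
      omega
    · simp [hx z hz]
  · exact hx y hy

end IsDistanceRegular

end SphereSum

/-! ### Distance polynomials; there are exactly `G.diam + 1` distinct eigenvalues. -/

/-- The monic polynomials with `p i (A) = (c 1 ⋯ c i) A i`, where `A i` is the `i`-th distance
matrix. -/
noncomputable def distancePolynomial (b c : ℕ → ℕ) : ℕ → ℝ[X]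
  | 0 => 1
  | 1 => X - C (intersectionA b c 0 : ℝ)
  | i + 2 => (X - C (intersectionA b c (i + 1) : ℝ)) * distancePolynomial b c (i + 1) -
      C (b i * c (i + 1) : ℝ) * distancePolynomial b c i

theorem distancePolynomial_monic_natDegree (b c : ℕ → ℕ) (i : ℕ) :
    (distancePolynomial b c i).Monic ∧ (distancePolynomial b c i).natDegree = i := by
  induction i using Nat.twoStepInduction with
  | zero => simp [distancePolynomial]
  | one => exact ⟨monic_X_sub_C _, natDegree_X_sub_C _⟩
  | more i h0 h1 =>
    have hm : ((X - C (intersectionA b c (i + 1) : ℝ)) * distancePolynomial b c (i + 1)).Monic :=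
      (monic_X_sub_C _).mul h1.1
    have hn : ((X - C (intersectionA b c (i + 1) : ℝ)) *
        distancePolynomial b c (i + 1)).natDegree = i + 2 := by
      rw [(monic_X_sub_C _).natDegree_mul h1.1, natDegree_X_sub_C, h1.2]; ring
    have hlt : (C (b i * c (i + 1) : ℝ) * distancePolynomial b c i).natDegree <
        ((X - C (intersectionA b c (i + 1) : ℝ)) * distancePolynomial b c (i + 1)).natDegree := by
      rw [hn]
      exact (natDegree_C_mul_le _ _).trans_lt (by omega)
    rw [distancePolynomial]
    refine ⟨hm.sub_of_left (degree_lt_degree hlt), ?_⟩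
    rw [natDegree_sub_eq_left_of_natDegree_lt hlt, hn]

theorem IsDistanceRegular.eval_distancePolynomial {V : Type*} [Fintype V] {G : SimpleGraph V}
    [DecidableRel G.Adj] {b c : ℕ → ℕ} (hG : G.IsDistanceRegular b c) {v : V → ℝ} {μ : ℝ}
    (h : G.adjMatrix ℝ *ᵥ v = μ • v) (y : V) (i : ℕ) :
    (distancePolynomial b c i).eval μ * v y =
      (∏ j ∈ Finset.range i, (c (j + 1) : ℝ)) * G.sphereSum v y i := by
  induction i using Nat.twoStepInduction with
  | zero => simp [distancePolynomial, hG.connected.sphereSum_zero]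
  | one =>
    have := hG.mul_sphereSum_zero h y
    rw [hG.connected.sphereSum_zero] at this
    simp only [distancePolynomial, eval_sub, eval_X, eval_C, Finset.prod_range_one, zero_add]
    linear_combination this
  | more i h0 h1 =>
    have := hG.mul_sphereSum_succ h y i
    simp only [distancePolynomial, eval_sub, eval_mul, eval_X, eval_C]
    rw [Finset.prod_range_succ] at h1 ⊢
    rw [Finset.prod_range_succ]
    linear_combination (μ - intersectionA b c (i + 1)) * h1 - (b i * c (i + 1) : ℝ) * h0 +
      (∏ j ∈ Finset.range i, (c (j + 1) : ℝ)) * c (i + 1) * this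

section Spectrum

variable {V : Type*} [Fintype V] [DecidableEq V] {G : SimpleGraph V} [DecidableRel G.Adj]

/-- Spheres of radius `G.diam + 1` are empty, so every eigenvalue is a root of the distance
polynomial of that degree. -/
theorem IsDistanceRegular.ncard_spectrum_le {b c : ℕ → ℕ} (hG : G.IsDistanceRegular b c) :
    (spectrum ℝ (G.adjMatrix ℝ)).ncard ≤ G.diam + 1 := by
  obtain ⟨hm, hn⟩ := distancePolynomial_monic_natDegree b c (G.diam + 1)
  have hsub : spectrum ℝ (G.adjMatrix ℝ) ⊆
      ((distancePolynomial b c (G.diam + 1)).roots.toFinset : Set ℝ) := by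
    intro μ hμ
    obtain ⟨v, hv, h⟩ := exists_mulVec_eq_of_mem_spectrum hμ
    obtain ⟨y, hy⟩ := Function.ne_iff.1 hv
    have h1 := hG.eval_distancePolynomial h y (G.diam + 1)
    rw [hG.connected.sphereSum_eq_zero y (Nat.lt_succ_self _), mul_zero] at h1
    simpa [hm.ne_zero] using (mul_eq_zero.1 h1).resolve_right hy
  calc (spectrum ℝ (G.adjMatrix ℝ)).ncard
      ≤ (distancePolynomial b c (G.diam + 1)).roots.toFinset.card := by
        rw [← Set.ncard_coe_finset]
        exact Set.ncard_le_ncard hsub (Finset.finite_toSet _)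
    _ ≤ (distancePolynomial b c (G.diam + 1)).roots.card := Multiset.toFinset_card_le _
    _ ≤ G.diam + 1 := (card_roots' _).trans hn.le

theorem adjMatrix_pow_apply_eq_zero {x y : V} {i : ℕ} (h : i < G.dist x y) :
    (G.adjMatrix ℝ ^ i) x y = 0 := by
  rw [adjMatrix_pow_apply_eq_card_walk, Nat.cast_eq_zero, Fintype.card_eq_zero_iff]
  exact ⟨fun p => by have := dist_le p.1; rw [p.2] at this; omega⟩

theorem Connected.adjMatrix_pow_dist_ne_zero (hG : G.Connected) (x y : V) :
    (G.adjMatrix ℝ ^ G.dist x y) x y ≠ 0 := by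
  rw [adjMatrix_pow_apply_eq_card_walk, Nat.cast_ne_zero]
  obtain ⟨p, hp⟩ := hG.exists_walk_length_eq_dist x y
  exact (Fintype.card_pos_iff.2 ⟨⟨p, hp⟩⟩).ne'

theorem Connected.diam_lt_ncard_spectrum (hG : G.Connected) :
    G.diam < (spectrum ℝ (G.adjMatrix ℝ)).ncard := by
  by_contra! hle
  have hfin := finite_real_spectrum (A := G.adjMatrix ℝ)
  rw [Set.ncard_eq_toFinset_card _ hfin] at hle
  -- With `x`, `y` at distance equal to the number of eigenvalues, which is the degree of the
  -- annihilating polynomial `P`, only the leading power contributes to the `(x, y)` entry.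
  obtain ⟨x, y, hxy⟩ := hG.exists_dist_eq hle
  let P : ℝ[X] := ∏ μ ∈ hfin.toFinset, (X - C μ)
  have hP : P.Monic := monic_prod_of_monic _ _ fun μ _ => monic_X_sub_C μ
  have hdeg : P.natDegree = hfin.toFinset.card := by
    simp [P, natDegree_prod_of_monic _ (fun μ : ℝ => X - C μ) fun μ _ => monic_X_sub_C μ]
  have h0 : aeval (G.adjMatrix ℝ) P = 0 :=
    (isHermitian_adjMatrix ℝ G).aeval_eq_zero fun μ hμ => by
      rw [eval_prod]
      exact Finset.prod_eq_zero (hfin.mem_toFinset.2 hμ) (by simp)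
  have h1 := congrFun (congrFun h0 x) y
  rw [aeval_eq_sum_range, Matrix.sum_apply, hdeg, Finset.sum_range_succ,
    Finset.sum_eq_zero fun i hi => ?_, zero_add, ← hdeg, hP.coeff_natDegree, one_smul, hdeg,
    ← hxy] at h1
  · exact hG.adjMatrix_pow_dist_ne_zero x y h1
  · rw [Matrix.smul_apply, adjMatrix_pow_apply_eq_zero (hxy ▸ Finset.mem_range.1 hi), smul_zero]

theorem IsDistanceRegular.exists_isDistinctEigenvalues {b c : ℕ → ℕ}
    (hG : G.IsDistanceRegular b c) :
    ∃ θ : Fin (G.diam + 1) → ℝ, G.IsDistinctEigenvalues θ := by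
  have hfin := finite_real_spectrum (A := G.adjMatrix ℝ)
  have hcard : hfin.toFinset.card = G.diam + 1 := by
    rw [← Set.ncard_eq_toFinset_card _ hfin]
    exact le_antisymm hG.ncard_spectrum_le hG.connected.diam_lt_ncard_spectrum
  refine ⟨fun i => hfin.toFinset.orderEmbOfFin hcard i.rev, fun i j hij => ?_, ?_⟩
  · exact (OrderEmbedding.lt_iff_lt _).2 (Fin.rev_lt_rev.2 hij)
  · refine (Fin.revPerm.surjective.range_comp (hfin.toFinset.orderEmbOfFin hcard)).trans ?_
    rw [Finset.range_orderEmbOfFin, hfin.coe_toFinset]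

end Spectrum

end SimpleGraph

namespace SimpleGraph

open Matrix Polynomial

/-! ### Extending local eigenvectors by zero: the strict bounds. -/

section LocalGraph

variable {V : Type*} [Fintype V] [DecidableEq V] {G : SimpleGraph V} [DecidableRel G.Adj] {x : V}

omit [DecidableEq V] in
theorem sum_extend_mul (u : G.neighborSet x → ℝ) (f : V → ℝ) :
    ∑ z, Function.extend Subtype.val u 0 z * f z = ∑ z : G.neighborSet x, u z * f z := by
  symm
  refine Fintype.sum_of_injective _ Subtype.val_injective _ _ (fun z hz => ?_) fun z => ?_
  · rw [Function.extend_apply' _ _ _ (by simpa using hz), Pi.zero_apply, zero_mul]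
  · rw [Subtype.val_injective.extend_apply]

omit [DecidableEq V] in
theorem adjMatrix_mulVec_extend (u : G.neighborSet x → ℝ) (z : G.neighborSet x) :
    (G.adjMatrix ℝ *ᵥ Function.extend Subtype.val u 0) z =
      ((G.localGraph x).adjMatrix ℝ *ᵥ u) z := by
  simp only [mulVec, dotProduct]
  simp_rw [mul_comm (G.adjMatrix ℝ z _), sum_extend_mul]
  refine Finset.sum_congr rfl fun w _ => ?_
  simp [adjMatrix_apply, mul_comm]

omit [DecidableEq V] in
theorem extend_dotProduct_self (u : G.neighborSet x → ℝ) :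
    Function.extend Subtype.val u 0 ⬝ᵥ Function.extend Subtype.val u 0 = u ⬝ᵥ u := by
  simp only [dotProduct]
  rw [sum_extend_mul]
  simp

omit [DecidableEq V] in
theorem extend_dotProduct_mulVec (u : G.neighborSet x → ℝ) :
    Function.extend Subtype.val u 0 ⬝ᵥ G.adjMatrix ℝ *ᵥ Function.extend Subtype.val u 0 =
      u ⬝ᵥ (G.localGraph x).adjMatrix ℝ *ᵥ u := by
  rw [dotProduct, sum_extend_mul]
  simp only [adjMatrix_mulVec_extend]
  rfl

namespace IsDistanceRegular

variable {b c : ℕ → ℕ}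

omit [DecidableEq V] in
theorem extend_ne_eigenvector (hG : G.IsDistanceRegular b c) (hD : 3 ≤ G.diam)
    {u : G.neighborSet x → ℝ} (hu : u ≠ 0) (t : ℝ) :
    G.adjMatrix ℝ *ᵥ Function.extend Subtype.val u 0 ≠ t • Function.extend Subtype.val u 0 := by
  intro h
  refine hu (funext fun z => ?_)
  have h0 := hG.eigenvector_eq_zero hD h (x := x) fun z hz =>
    Function.extend_apply' _ _ _ (by simpa using hz)
  rw [← Subtype.val_injective.extend_apply u 0 z, h0]
  rfl

theorem local_eigenvalue_lt (hG : G.IsDistanceRegular b c) (hD : 3 ≤ G.diam)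
    {u : G.neighborSet x → ℝ} (hu : u ≠ 0) {η t : ℝ}
    (h : (G.localGraph x).adjMatrix ℝ *ᵥ u = η • u) (h1 : 1 ⬝ᵥ u = 0)
    (ht : ∀ μ ∈ spectrum ℝ (G.adjMatrix ℝ), t < μ → μ = b 0) : η < t := by
  by_contra! hle
  refine hG.extend_ne_eigenvector hD hu t
    ((isHermitian_adjMatrix ℝ G).mulVec_eq_smul_of_le (fun μ w hw hμ => ?_) ?_)
  · rcases eq_or_ne w 0 with rfl | hw0
    · simp
    rw [ht μ (mem_spectrum_of_mulVec_eq hw0 hw) hμ] at hw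
    -- An eigenvector for an eigenvalue above `t` is constant, hence orthogonal to the extension of
    -- `u`.
    have hc := hG.isRegularOfDegree.eigenvector_eq hG.connected hw
    rw [dotProduct_comm, dotProduct, sum_extend_mul]
    simp_rw [fun z : V => hc z x]
    rw [← Finset.sum_mul, ← one_dotProduct, h1, zero_mul]
  · rw [extend_dotProduct_self, extend_dotProduct_mulVec, h, dotProduct_smul, smul_eq_mul]
    exact mul_le_mul_of_nonneg_right hle (Finset.sum_nonneg fun i _ => mul_self_nonneg (u i))

theorem lt_local_eigenvalue (hG : G.IsDistanceRegular b c) (hD : 3 ≤ G.diam)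
    {u : G.neighborSet x → ℝ} (hu : u ≠ 0) {η t : ℝ}
    (h : (G.localGraph x).adjMatrix ℝ *ᵥ u = η • u)
    (ht : ∀ μ ∈ spectrum ℝ (G.adjMatrix ℝ), t ≤ μ) : t < η := by
  by_contra! hle
  -- For the negated matrix no eigenvalue exceeds `-t`, so the orthogonality condition is vacuous up
  -- to `w = 0`.
  have key := (isHermitian_adjMatrix ℝ G).neg.mulVec_eq_smul_of_le (t := -t)
    (v := Function.extend Subtype.val u 0) (fun μ w hw hμ => ?_) ?_
  · rw [neg_mulVec, neg_smul, neg_inj] at key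
    exact hG.extend_ne_eigenvector hD hu t key
  · rcases eq_or_ne w 0 with rfl | hw0
    · simp
    rw [neg_mulVec, neg_eq_iff_eq_neg, ← neg_smul] at hw
    linarith [ht _ (mem_spectrum_of_mulVec_eq hw0 hw)]
  · rw [neg_mulVec, dotProduct_neg, extend_dotProduct_self, extend_dotProduct_mulVec, h,
      dotProduct_smul, smul_eq_mul]
    rw [neg_mul, neg_le_neg_iff]
    exact mul_le_mul_of_nonneg_right hle (Finset.sum_nonneg fun i _ => mul_self_nonneg (u i))

theorem localGraph_isRegularOfDegree (hG : G.IsDistanceRegular b c) (x : V) :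
    (G.localGraph x).IsRegularOfDegree (b 0 - b 1 - c 1) := by
  intro y
  have hy : G.dist x y = 1 := dist_eq_one_iff_adj.2 y.2
  have h1 := hG.card_same x y
  rw [hy] at h1
  have h2 : (G.localGraph x).degree y =
      ((G.neighborFinset y).filter fun z => G.dist x z = 1).card := by
    rw [← card_neighborFinset_eq_degree, ← Finset.card_map (.subtype (· ∈ G.neighborSet x)),
      map_neighborFinset_induce]
    congr 1
    ext z
    simp
  omega

end IsDistanceRegular

end LocalGraph

/-! ### The second eigenvector, and the case of equality. -/

section SecondEigenvector

variable {n : Type*} [Fintype n] {A : Matrix n n ℝ}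

/-- If the constant vectors are eigenvectors of `A` for the eigenvalue of `u₀`, then some
eigenvector for the eigenvalue of `u₁` is orthogonal to them. -/
theorem _root_.Matrix.IsHermitian.exists_eigenvector_one_dotProduct_eq_zero
    (hA : A.IsHermitian) {α β : ℝ} {u₀ u₁ : n → ℝ} (h1 : A *ᵥ 1 = α • 1)
    (h₀ : A *ᵥ u₀ = α • u₀) (h₁ : A *ᵥ u₁ = β • u₁) (hu₀ : u₀ ⬝ᵥ u₀ = 1)
    (hu₁ : u₁ ≠ 0) (hu : u₀ ⬝ᵥ u₁ = 0) :
    ∃ w, w ≠ 0 ∧ A *ᵥ w = β • w ∧ 1 ⬝ᵥ w = 0 := by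
  by_cases h : 1 ⬝ᵥ u₁ = 0
  · exact ⟨u₁, hu₁, h₁, h⟩
  -- By symmetry, eigenvectors for different eigenvalues are orthogonal; once `α = β`, a combination
  -- of `u₀` and `u₁` can be made orthogonal to `1`.
  have hαβ : α = β := by
    have h2 : 1 ⬝ᵥ A *ᵥ u₁ = A *ᵥ 1 ⬝ᵥ u₁ := by
      rw [dotProduct_mulVec, ← mulVec_transpose, ← conjTranspose_eq_transpose_of_trivial, hA.eq]
    rw [h1, h₁, dotProduct_smul, smul_dotProduct, smul_eq_mul, smul_eq_mul] at h2
    exact (mul_right_cancel₀ h h2).symm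
  subst hαβ
  refine ⟨(1 ⬝ᵥ u₁) • u₀ - (1 ⬝ᵥ u₀) • u₁, fun h0 => h ?_, ?_, ?_⟩
  · have := congrArg (u₀ ⬝ᵥ ·) h0
    simpa [dotProduct_sub, hu₀, hu] using this
  · rw [mulVec_sub, mulVec_smul, mulVec_smul, h₀, h₁, smul_sub, smul_comm α, smul_comm α]
  · rw [dotProduct_sub, dotProduct_smul, dotProduct_smul, smul_eq_mul, smul_eq_mul]; ring

end SecondEigenvector

section Constant

variable {V : Type*} [Fintype V] [DecidableEq V] [Nonempty V] {G : SimpleGraph V}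
  [DecidableRel G.Adj]

/-- A nonempty `d`-regular graph with `d > 0` whose eigenvalues other than the first coincide is
complete. -/
theorem IsRegularOfDegree.add_one_eq_of_eigenvalues {d m : ℕ} (hd : G.IsRegularOfDegree d)
    (hd0 : d ≠ 0) {η : Fin (m + 1) → ℝ} (hη : G.IsEigenvalues η) (h0 : η 0 = d) {e : ℝ}
    (he : ∀ i, i ≠ 0 → η i = e) : d = m := by
  have hA := isHermitian_adjMatrix ℝ G
  have hspec : ∀ μ ∈ spectrum ℝ (G.adjMatrix ℝ), μ = d ∨ μ = e := by
    intro μ hμ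
    rw [mem_spectrum_iff_isRoot_charpoly, ← mem_roots (charpoly_monic _).ne_zero,
      ← hη.roots_eq, Multiset.mem_map] at hμ
    obtain ⟨i, -, rfl⟩ := hμ
    rcases eq_or_ne i 0 with rfl | hi
    · exact .inl h0
    · exact .inr (he i hi)
  -- The polynomial is `(X - d)(X - e)`. A diagonal entry of the relation reads `d + d * e = 0`, so
  -- `e = -1`; the zero trace then gives `d = m`.
  have hq := hA.aeval_eq_zero (p := X ^ 2 - C (d + e) * X + C (d * e)) fun μ hμ => by
    rcases hspec μ hμ with rfl | rfl <;> simp <;> ring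
  obtain ⟨y⟩ := ‹Nonempty V›
  have hy := congrFun (congrFun hq y) y
  have h2 : (G.adjMatrix ℝ * G.adjMatrix ℝ) y y = d := by
    rw [adjMatrix_mul_self_apply_self, hd y]
  have h3 : (d : ℝ) * (1 + e) = 0 := by
    rw [map_add, map_sub, map_mul, map_pow, aeval_X, aeval_C, aeval_C,
      Algebra.algebraMap_eq_smul_one, Algebra.algebraMap_eq_smul_one, smul_mul_assoc, one_mul,
      pow_two, Matrix.add_apply, Matrix.sub_apply, h2, Matrix.smul_apply, Matrix.smul_apply,
      adjMatrix_apply, if_neg (G.irrefl), one_apply_eq, Matrix.zero_apply] at hy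
    simp only [smul_eq_mul] at hy
    linarith
  have he1 : e = -1 := by
    have := (mul_eq_zero.1 h3).resolve_left (by exact_mod_cast hd0)
    linarith
  have htr : ∑ i, η i = 0 := by
    rw [Finset.sum, hη.roots_eq, ← trace_eq_sum_roots_charpoly_of_splits hA.splits_charpoly,
      trace_adjMatrix]
  rw [Fin.sum_univ_succ, h0, Finset.sum_congr rfl fun i _ => he i.succ (Fin.succ_ne_zero i), he1]
    at htr
  simp at htr
  exact_mod_cast (by linarith : (d : ℝ) = m)

end Constant

end SimpleGraph

/-! ### Assembly of the theorem. -/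

theorem corollary3p7 {V : Type*} [Fintype V] [DecidableEq V] (G : SimpleGraph V)
    [DecidableRel G.Adj] (b c : ℕ → ℕ) (hG : G.IsDistanceRegular b c) (hD : 3 ≤ G.diam) (x : V) :
    ∃ (θ : Fin (G.diam + 1) → ℝ) (η : Fin (b 0) → ℝ) (hk : 2 ≤ b 0),
      G.IsDistinctEigenvalues θ ∧ (G.localGraph x).IsEigenvalues η ∧
      θ 0 = (b 0 : ℝ) ∧
      η ⟨0, by omega⟩ = (SimpleGraph.intersectionA b c 1 : ℝ) ∧
      θ 1 > η ⟨1, by omega⟩ ∧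
      η ⟨1, by omega⟩ ≥ η ⟨b 0 - 1, by omega⟩ ∧
      (η ⟨1, by omega⟩ = η ⟨b 0 - 1, by omega⟩ ↔ SimpleGraph.intersectionA b c 1 = 0) ∧
      η ⟨b 0 - 1, by omega⟩ > θ (Fin.last G.diam) := by
  open SimpleGraph Matrix in
  have hb1 : 0 < b 1 := hG.b_pos (by omega)
  have hc1 : c 1 = 1 := hG.c_one (by omega)
  obtain ⟨x₁, y₁, hxy⟩ := hG.connected.exists_dist_eq (i := 1) (by omega)
  have hle := hG.card_same x₁ y₁
  rw [hxy] at hle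
  have hk : 2 ≤ b 0 := by omega
  have hreg := hG.isRegularOfDegree
  have hloc := hG.localGraph_isRegularOfDegree x
  -- The natural subtraction is not truncated: `hle` gives `b 1 + c 1 ≤ b 0`.
  set a := b 0 - b 1 - c 1 with ha
  have haA : intersectionA b c 1 = a := by rw [intersectionA]; omega
  obtain ⟨θ, hθ⟩ := hG.exists_isDistinctEigenvalues
  have hcard : Fintype.card (G.neighborSet x) = b 0 := by rw [card_neighborSet_eq_degree, hreg x]
  have hA := isHermitian_adjMatrix ℝ (G.localGraph x)
  obtain ⟨η, u, hanti, hroots, hu, ho, -⟩ := hA.exists_sorted_eigenbasis hcard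
  have hu0 : ∀ i, u i ≠ 0 := fun i h0 => by simpa [h0] using ho i i
  have hNe : Nonempty (G.neighborSet x) := Fintype.card_pos_iff.1 (by omega)
  have hVe : Nonempty V := ⟨x⟩
  have hη : (G.localGraph x).IsEigenvalues η := ⟨hanti, hroots⟩
  have hθle : ∀ μ ∈ spectrum ℝ (G.adjMatrix ℝ), ∃ i, θ i = μ := fun μ hμ => by
    rwa [← hθ.range_eq] at hμ
  have hθ0 : θ 0 = b 0 := by
    obtain ⟨i, hi⟩ := hθle _ hreg.mem_spectrum
    obtain ⟨v, hv, h⟩ := exists_mulVec_eq_of_mem_spectrum (A := G.adjMatrix ℝ) (μ := θ 0)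
      (hθ.range_eq ▸ Set.mem_range_self 0)
    exact le_antisymm (hreg.eigenvalue_le hv h) (hi ▸ hθ.strictAnti.antitone (Fin.zero_le i))
  have hη0 : η ⟨0, by omega⟩ = a := by
    refine le_antisymm (hloc.eigenvalue_le (hu0 _) (hu _)) ?_
    have := hloc.mem_spectrum
    rw [mem_spectrum_iff_isRoot_charpoly, ← Polynomial.mem_roots (charpoly_monic _).ne_zero,
      ← hroots, Multiset.mem_map] at this
    obtain ⟨i, -, hi⟩ := this
    exact hi ▸ hanti (Fin.mk_le_of_le_val (Nat.zero_le _))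
  refine ⟨θ, η, hk, hθ, hη, hθ0, by rw [hη0, haA]; simp, ?_, ?_, ⟨fun h => ?_, fun h => ?_⟩, ?_⟩
  -- `u 1` itself need not be orthogonal to the constants: the eigenvalue `a` is repeated when the
  -- local graph is disconnected.
  · obtain ⟨w, hw0, hw, h1⟩ := hA.exists_eigenvector_one_dotProduct_eq_zero
      hloc.adjMatrix_mulVec_one (hη0 ▸ hu ⟨0, by omega⟩) (hu ⟨1, by omega⟩)
      (by rw [ho, if_pos rfl]) (hu0 _) (by rw [ho, if_neg (by simp [Fin.ext_iff])])
    refine hG.local_eigenvalue_lt hD hw0 hw h1 fun μ hμ hlt => ?_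
    obtain ⟨i, rfl⟩ := hθle μ hμ
    have hi : i < 1 := hθ.strictAnti.lt_iff_gt.1 hlt
    rw [← hθ0]
    congr 1
    have : (1 : Fin (G.diam + 1)).val = 1 :=
      (Fin.val_one' _).trans (Nat.mod_eq_of_lt (by omega))
    ext
    have := Fin.lt_def.1 hi
    simp only [Fin.val_zero]
    omega
  · exact hanti (Fin.mk_le_mk.2 (by omega))
  · by_contra hne
    obtain ⟨m, hm⟩ : ∃ m, b 0 = m + 1 := ⟨b 0 - 1, by omega⟩
    have hcast : (Fin.cast hm.symm : Fin (m + 1) → Fin (b 0)) = finCongr hm.symm := rfl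
    -- This yields `a = b 0 - 1`, contradicting `b 1 > 0` and `c 1 = 1`.
    have := hloc.add_one_eq_of_eigenvalues (m := m) (η := η ∘ Fin.cast hm.symm)
      (e := η ⟨1, by omega⟩) (by omega) ⟨fun i j hij => hanti hij, ?_⟩ hη0 fun i hi => ?_
    · omega
    · rw [← hroots, hcast, ← Multiset.map_map]
      congr 1
      exact congrArg Finset.val (Finset.map_univ_equiv (finCongr hm.symm))
    · have hi' : i.val ≠ 0 := fun h0 => hi (Fin.ext h0)
      refine le_antisymm (hanti (Fin.mk_le_of_le_val ?_)) (h ▸ hanti (Fin.le_def.2 ?_))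
      · simp only [Fin.val_cast]; omega
      · simp only [Fin.val_cast]; omega
  · have ha0 : a = 0 := by omega
    have hz : (G.localGraph x).adjMatrix ℝ = 0 := by
      ext y z
      have hy := hloc y
      rw [ha0, ← card_neighborFinset_eq_degree, Finset.card_eq_zero] at hy
      have : ¬ (G.localGraph x).Adj y z := fun hadj => by
        simpa [hy] using (mem_neighborFinset _ _ _).2 hadj
      rw [adjMatrix_apply, if_neg this, Matrix.zero_apply]
    have h0 : ∀ i, η i = 0 := fun i => by
      have := hu i
      rw [hz, zero_mulVec] at this
      exact (smul_eq_zero.1 this.symm).resolve_right (hu0 i)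
    rw [h0, h0]
  · refine hG.lt_local_eigenvalue hD (hu0 _) (hu _) fun μ hμ => ?_
    obtain ⟨i, rfl⟩ := hθle μ hμ
    exact hθ.strictAnti.antitone (Fin.le_last i)
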